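/- Let $q$ be a prime power. For $n \ge 0$ let $E(q,n)$ be the set of all linear subspaces of $\mathrm{GF}(q)^n$, equipped with the injection metric $$d_I(U,V) = \max\{\dim U, \dim V\} - \dim(U\cap V) = \tfrac12\bigl(\dim(U+V)-\dim(U\cap V)\bigr) + \tfrac12\,|\dim U-\dim V|.$$ The injection covering radius of a nonempty code $\mathcal{C} \subseteq E(q,n)$ is $\max_{U\in E(q,n)} \min_{V\in\mathcal{C}} d_I(U,V)$. Let $K_I(q,n,\rho)$ be the minimum cardinality of a nonempty code $\mathcal{C} \subseteq E(q,n)$ with injection covering radius at most $\rho$, and for real $\rho' \ge 0$ let $$k_I(\rho') = \liminf_{n\to\infty} \frac{\log_q K_I(q,n,\lfloor n\rho'\rfloor)}{\log_q |E(q,n)|}.$$ Then $k_I(\rho') = (1-2\rho')^2$ for $0 \le \rho' \le \tfrac12$, and $k_I(\rho') = 0$ for $\rho' \ge \tfrac12$. -/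

import Mathlib

open Filter Topology

noncomputable section

namespace SubspaceCodes

/-- The projective space `E(q,n)`: the set of all subspaces of `F ^ n`, where `F` is a field
with `q` elements. -/
abbrev ProjSpace (F : Type*) [Field F] (n : ℕ) : Type _ := Submodule F (Fin n → F)

/-- The subspace distance `dim (U + V) - dim (U ∩ V)`; the subtraction does not truncate. -/
def subspaceDist {F : Type*} [Field F] {n : ℕ} (U V : ProjSpace F n) : ℕ :=
  Module.finrank F ↥(U ⊔ V) - Module.finrank F ↥(U ⊓ V)

/-- The injection distance `max (dim U) (dim V) - dim (U ∩ V)`; the subtraction does not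
truncate. -/
def injectionDist {F : Type*} [Field F] {n : ℕ} (U V : ProjSpace F n) : ℕ :=
  max (Module.finrank F ↥U) (Module.finrank F ↥V) - Module.finrank F ↥(U ⊓ V)

/-- The injection distance is half the subspace distance plus half the difference of the
dimensions. -/
theorem injectionDist_eq {F : Type*} [Field F] {n : ℕ} (U V : ProjSpace F n) :
    (injectionDist U V : ℝ) = (1 / 2) * (subspaceDist U V : ℝ)
      + (1 / 2) * |(Module.finrank F ↥U : ℝ) - (Module.finrank F ↥V : ℝ)| := by
  have h := Submodule.finrank_sup_add_finrank_inf_eq U V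
  have h1 : Module.finrank F ↥(U ⊓ V) ≤ Module.finrank F ↥U :=
    Submodule.finrank_mono inf_le_left
  have h2 : Module.finrank F ↥(U ⊓ V) ≤ Module.finrank F ↥V :=
    Submodule.finrank_mono inf_le_right
  have h3 : Module.finrank F ↥(U ⊓ V) ≤ Module.finrank F ↥(U ⊔ V) :=
    Submodule.finrank_mono (inf_le_left.trans le_sup_left)
  have hr : (Module.finrank F ↥(U ⊔ V) : ℝ) + (Module.finrank F ↥(U ⊓ V) : ℝ)
      = (Module.finrank F ↥U : ℝ) + (Module.finrank F ↥V : ℝ) := by exact_mod_cast h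
  unfold injectionDist subspaceDist
  rw [Nat.cast_sub (h1.trans (le_max_left _ _)), Nat.cast_sub h3]
  push_cast
  rcases le_total (Module.finrank F ↥U : ℝ) (Module.finrank F ↥V : ℝ) with hle | hle
  · rw [max_eq_right hle, abs_of_nonpos (by linarith)]; linarith
  · rw [max_eq_left hle, abs_of_nonneg (by linarith)]; linarith

/-- The injection distance `d(U, C) = min_{V ∈ C} d(U, V)` from a subspace to a (nonempty)
code. -/
def injectionDistToCode {F : Type*} [Field F] {n : ℕ} (U : ProjSpace F n)
    (C : Set (ProjSpace F n)) : ℕ :=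
  sInf (injectionDist U '' C)

/-- The injection covering radius `max_U d(U, C)` of a (nonempty) code `C` in `E(q,n)`. The
maximum is over a finite set when `F` is finite. -/
def injectionCoveringRadius {F : Type*} [Field F] {n : ℕ} (C : Set (ProjSpace F n)) : ℕ :=
  ⨆ U : ProjSpace F n, injectionDistToCode U C

/-- `K_I(q,n,ρ)`: the minimum cardinality of a subspace code (a nonempty subset of `E(q,n)`)
that covers `E(q,n)` with injection radius `ρ`, that is, of injection covering radius at
most `ρ`. -/
def minCoveringCard (F : Type*) [Field F] (n ρ : ℕ) : ℕ :=
  sInf {m : ℕ | ∃ C : Set (ProjSpace F n),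
    C.Nonempty ∧ injectionCoveringRadius C ≤ ρ ∧ C.ncard = m}

/-- The minimum defining `K_I(q,n,ρ)` is over a nonempty set, hence attained. -/
theorem exists_minCoveringCard (F : Type*) [Field F] (n ρ : ℕ) :
    ∃ C : Set (ProjSpace F n), C.Nonempty ∧ injectionCoveringRadius C ≤ ρ ∧
      C.ncard = minCoveringCard F n ρ := by
  refine Nat.sInf_mem (s := {m : ℕ | ∃ C : Set (ProjSpace F n),
    C.Nonempty ∧ injectionCoveringRadius C ≤ ρ ∧ C.ncard = m})
    ⟨_, Set.univ, Set.univ_nonempty, ?_, rfl⟩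
  refine (ciSup_le fun U => ?_).trans (Nat.zero_le ρ)
  exact Nat.sInf_le ⟨U, Set.mem_univ U, by rw [injectionDist, inf_idem, max_self, Nat.sub_self]⟩

/-- The asymptotic rate
`k_I(ρ') = liminf_{n → ∞} log_q K_I(q, n, ⌊n ρ'⌋) / log_q |E(q,n)|`, with `q = |F|`. The
limit inferior is taken in the extended reals, where it always exists. -/
def injectionCoveringRate (F : Type*) [Field F] (ρ' : ℝ) : EReal :=
  liminf (fun n : ℕ =>
    ((Real.logb (Nat.card F) (minCoveringCard F n ⌊(n : ℝ) * ρ'⌋₊ : ℝ)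
      / Real.logb (Nat.card F) (Nat.card (ProjSpace F n) : ℝ) : ℝ) : EReal)) atTop

end SubspaceCodes

end

/-!
Over a field with `q` elements, an `n`-dimensional space has `q ^ (k * (n - k) + O(n))` subspaces of
dimension `k`, because each factor `q ^ n - q ^ i` in the count of independent `k`-tuples is within
a factor `q` of `q ^ (n - k) * (q ^ k - q ^ i)`.

Lower bound: a `k`-dimensional `U` at injection distance at most `ρ` from `V` meets `V` in dimension
at least `max k (dim V) - ρ`. Choosing a subspace of `V` of that dimension and then `U` above it
shows that there are at most `q ^ (ρ * (n - ρ) + k)` such `U`. Sphere covering in the middle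
dimension `k = n / 2` gives `log K ≥ (n - 2 * ρ) ^ 2 / 4 - O(n)`.

Upper bound: for `A ≤ B` of dimension and codimension at most `ρ`, every `U` is within distance `ρ`
of `A ⊔ U ⊓ B`, so the interval `[A, B]` is a covering code, with as many elements as the quotient
`B / A` of dimension `n - 2 * ρ` has subspaces.

Since only the full code has covering radius `0`, the denominator of the rate is the case `ρ = 0`
of the numerator.
-/

namespace SubspaceCodes

open Module Finset

theorem ncard_le_ncard_mul_of_forall_exists {α β : Type*} {s : Set α} {t : Set β} {r : α → β → Prop}
    {N : ℕ} (ht : t.Finite) (hst : ∀ a ∈ s, ∃ b ∈ t, r a b)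
    (hN : ∀ b ∈ t, {a ∈ s | r a b}.ncard ≤ N) : s.ncard ≤ t.ncard * N := by
  classical
  rcases s.finite_or_infinite with hs | hs
  · lift s to Finset α using hs
    lift t to Finset β using ht
    simp only [Set.ncard_coe_finset]
    calc #s ≤ #(t.biUnion fun b => {a ∈ s | r a b}) := card_le_card fun a ha => by
          obtain ⟨b, hb, hab⟩ := hst a ha
          exact mem_biUnion.2 ⟨b, hb, mem_filter.2 ⟨ha, hab⟩⟩
      _ ≤ #t * N := card_biUnion_le_card_mul _ _ _ fun b hb => by
          rw [← Set.ncard_coe_finset, coe_filter]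
          exact hN b hb
  · simp [hs.ncard]

theorem pow_mul_pow_sub_pow_le (q k d i : ℕ) :
    q ^ d * (q ^ k - q ^ i) ≤ q ^ (k + d) - q ^ i := by
  rcases Nat.eq_zero_or_pos q with rfl | hq
  · rcases k with _ | k <;> rcases d with _ | d <;> rcases i with _ | i <;> simp
  · rw [Nat.mul_sub, add_comm, pow_add]
    exact Nat.sub_le_sub_left (Nat.le_mul_of_pos_left _ (pow_pos hq d)) _

theorem pow_sub_pow_le_pow_mul {q k i : ℕ} (d : ℕ) (hq : 2 ≤ q) (hi : i < k) :
    q ^ (k + d) - q ^ i ≤ q ^ (d + 1) * (q ^ k - q ^ i) := by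
  have hpow : q ^ k ≤ q * (q ^ k - q ^ i) := by
    have h₁ : q * q ^ i ≤ q ^ k := by
      rw [← pow_succ']
      exact Nat.pow_le_pow_right (by lia) hi
    have h₂ : 2 * q ^ k ≤ q * q ^ k := Nat.mul_le_mul_right _ hq
    rw [Nat.mul_sub]
    lia
  calc q ^ (k + d) - q ^ i ≤ q ^ d * q ^ k := by rw [← pow_add, add_comm d]; exact Nat.sub_le _ _
    _ ≤ q ^ d * (q * (q ^ k - q ^ i)) := Nat.mul_le_mul_left _ hpow
    _ = q ^ (d + 1) * (q ^ k - q ^ i) := by rw [pow_succ, mul_assoc]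

theorem prod_pow_sub_pow_pos {q : ℕ} (hq : 2 ≤ q) (k : ℕ) :
    0 < ∏ i : Fin k, (q ^ k - q ^ i.val) :=
  prod_pos fun i _ => Nat.sub_pos_of_lt (Nat.pow_lt_pow_right hq i.2)

/-- The left side is the exponent of a count of the `k`-dimensional `U` with `dim (U ∩ V) ≥ w`,
where `b = dim V - w`; for `w = max k (dim V) - ρ` these are the `U` with `d_I(U, V) ≤ ρ`. -/
theorem mul_succ_add_sub_mul_succ_le {n k ρ w b : ℕ} (hk : k + ρ ≤ n) (hwk : w ≤ k)
    (hkw : k ≤ w + ρ) (hb : b ≤ ρ) :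
    w * (b + 1) + (k - w) * (n - k + 1) ≤ ρ * (n - ρ) + k := by
  obtain ⟨a, rfl⟩ := Nat.exists_eq_add_of_le hwk
  obtain ⟨e, rfl⟩ := Nat.exists_eq_add_of_le hk
  have haρ : a ≤ ρ := by lia
  calc w * (b + 1) + (w + a - w) * (w + a + ρ + e - (w + a) + 1)
      = w * (b + 1) + a * (ρ + 1) + a * e := by
        rw [Nat.add_sub_cancel_left, add_assoc (w + a), Nat.add_sub_cancel_left]
        ring
    _ ≤ w * (ρ + 1) + a * (ρ + 1) + ρ * e := by gcongr
    _ = ρ * (w + a + ρ + e - ρ) + (w + a) := by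
        rw [add_right_comm _ ρ e, Nat.add_sub_cancel]
        ring

section DivisionRing

variable {K M : Type*} [DivisionRing K] [AddCommGroup M] [Module K M]

theorem exists_submodule_le_finrank_eq (V : Submodule K M) {k : ℕ} (hk : k ≤ finrank K V) :
    ∃ W ≤ V, finrank K W = k := by
  obtain ⟨v, hv⟩ := exists_linearIndependent_of_le_finrank hk
  refine ⟨(Submodule.span K (Set.range v)).map V.subtype, Submodule.map_subtype_le _ _, ?_⟩
  rw [Submodule.finrank_map_subtype_eq, finrank_span_eq_card hv, Fintype.card_fin]

theorem span_range_coe_eq_of_finrank_eq {U : Submodule K M} [FiniteDimensional K U] {k : ℕ}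
    (hU : finrank K U = k) {v : Fin k → U} (hv : LinearIndependent K v) :
    Submodule.span K (Set.range fun i => (v i : M)) = U := by
  have htop := hv.span_eq_top_of_card_eq_finrank' (by rw [Fintype.card_fin, hU])
  calc Submodule.span K (Set.range fun i => (v i : M))
      = (Submodule.span K (Set.range v)).map U.subtype := by
        rw [Submodule.map_span, ← Set.range_comp]; rfl
    _ = U := by rw [htop, Submodule.map_subtype_top]

theorem finrank_map_mkQ [FiniteDimensional K M] {W U : Submodule K M} (hWU : W ≤ U) :
    finrank K (U.map W.mkQ) = finrank K U - finrank K W := by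
  have h := (W.mkQ.domRestrict U).finrank_range_add_finrank_ker
  rw [LinearMap.range_domRestrict, LinearMap.ker_domRestrict, Submodule.ker_mkQ,
    (Submodule.comapSubtypeEquivOfLe hWU).finrank_eq] at h
  lia

variable (K M) in
/-- The number of `k`-dimensional subspaces of `M`. For `M` of dimension `n` over a field with `q`
elements this is the Gaussian binomial coefficient `[n choose k]_q`. -/
noncomputable def subspaceCount (k : ℕ) : ℕ := {U : Submodule K M | finrank K U = k}.ncard

theorem natCard_submodule_eq_sum_subspaceCount [Finite M] :
    Nat.card (Submodule K M) = ∑ k ∈ range (finrank K M + 1), subspaceCount K M k := by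
  let dim (U : Submodule K M) : Fin (finrank K M + 1) :=
    ⟨finrank K U, Nat.lt_succ_of_le U.finrank_le⟩
  rw [Nat.card_congr (Equiv.sigmaFiberEquiv dim).symm, Nat.card_sigma, sum_range]
  exact sum_congr rfl fun k _ => Nat.card_congr <| Equiv.subtypeEquivRight fun U => Fin.ext_iff

theorem ncard_setOf_le_and_finrank_eq (V : Submodule K M) (k : ℕ) :
    {W | W ≤ V ∧ finrank K W = k}.ncard = subspaceCount K V k := by
  rw [subspaceCount, ← Set.ncard_image_of_injective _
    (Submodule.map_injective_of_injective V.injective_subtype)]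
  congr 1
  ext W
  constructor
  · rintro ⟨hWV, hW⟩
    have hmap : (W.submoduleOf V).map V.subtype = W := by
      rw [Submodule.submoduleOf, Submodule.map_comap_subtype, inf_eq_right.2 hWV]
    exact ⟨W.submoduleOf V, by rw [Set.mem_ofPred, ← Submodule.finrank_map_subtype_eq, hmap, hW],
      hmap⟩
  · rintro ⟨W, hW, rfl⟩
    exact ⟨Submodule.map_subtype_le _ _, by rwa [Submodule.finrank_map_subtype_eq]⟩

variable [Finite K] [Finite M]

theorem natCard_linearIndependent {k : ℕ} (hk : k ≤ finrank K M) :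
    Nat.card {v : Fin k → M // LinearIndependent K v}
      = ∏ i : Fin k, (Nat.card K ^ finrank K M - Nat.card K ^ i.val) := by
  have := Fintype.ofFinite K
  rw [card_linearIndependent hk, Nat.card_eq_fintype_card]

theorem natCard_linearIndependent_span_eq {U : Submodule K M} {k : ℕ} (hU : finrank K U = k) :
    Nat.card {v : {v : Fin k → M // LinearIndependent K v} //
        Submodule.span K (Set.range v.1) = U}
      = ∏ i : Fin k, (Nat.card K ^ k - Nat.card K ^ i.val) := by
  rw [← hU, ← natCard_linearIndependent le_rfl, hU]
  refine Nat.card_congr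
    { toFun v := ⟨fun i => ⟨v.1.1 i, ?_⟩, .of_comp U.subtype v.1.2⟩
      invFun v := ⟨⟨fun i => v.1 i, v.2.map' _ U.ker_subtype⟩,
        span_range_coe_eq_of_finrank_eq hU v.2⟩
      left_inv _ := rfl
      right_inv _ := rfl }
  exact v.2.le (Submodule.subset_span ⟨i, rfl⟩)

theorem subspaceCount_mul_prod {k : ℕ} (hk : k ≤ finrank K M) :
    subspaceCount K M k * ∏ i : Fin k, (Nat.card K ^ k - Nat.card K ^ i.val)
      = ∏ i : Fin k, (Nat.card K ^ finrank K M - Nat.card K ^ i.val) := by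
  let spanOf (v : {v : Fin k → M // LinearIndependent K v}) :
      {U : Submodule K M // finrank K U = k} :=
    ⟨Submodule.span K (Set.range v.1), by rw [finrank_span_eq_card v.2, Fintype.card_fin]⟩
  have := Fintype.ofFinite {U : Submodule K M // finrank K U = k}
  have hfiber (U : {U : Submodule K M // finrank K U = k}) :
      Nat.card {v // spanOf v = U} = ∏ i : Fin k, (Nat.card K ^ k - Nat.card K ^ i.val) := by
    simp only [spanOf, Subtype.ext_iff, ← natCard_linearIndependent_span_eq U.2]
  calc subspaceCount K M k * ∏ i : Fin k, (Nat.card K ^ k - Nat.card K ^ i.val)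
      = ∑ U, Nat.card {v // spanOf v = U} := by
        rw [sum_congr rfl fun U _ => hfiber U, sum_const, smul_eq_mul, card_univ,
          ← Nat.card_eq_fintype_card]
        rfl
    _ = ∏ i : Fin k, (Nat.card K ^ finrank K M - Nat.card K ^ i.val) := by
        rw [← Nat.card_sigma, Nat.card_congr (Equiv.sigmaFiberEquiv spanOf),
          natCard_linearIndependent hk]

theorem pow_le_subspaceCount {k : ℕ} (hk : k ≤ finrank K M) :
    Nat.card K ^ (k * (finrank K M - k)) ≤ subspaceCount K M k := by
  refine Nat.le_of_mul_le_mul_right ?_ (prod_pow_sub_pow_pos (Finite.one_lt_card (α := K)) k)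
  calc Nat.card K ^ (k * (finrank K M - k)) * ∏ i : Fin k, (Nat.card K ^ k - Nat.card K ^ i.val)
      = ∏ i : Fin k, (Nat.card K ^ (finrank K M - k) * (Nat.card K ^ k - Nat.card K ^ i.val)) := by
        rw [prod_mul_distrib, prod_const, card_univ, Fintype.card_fin, ← pow_mul, mul_comm k]
    _ ≤ ∏ i : Fin k, (Nat.card K ^ (k + (finrank K M - k)) - Nat.card K ^ i.val) :=
        prod_le_prod' fun i _ => pow_mul_pow_sub_pow_le _ _ _ _
    _ = subspaceCount K M k * ∏ i : Fin k, (Nat.card K ^ k - Nat.card K ^ i.val) := by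
        rw [subspaceCount_mul_prod hk, Nat.add_sub_cancel' hk]

theorem subspaceCount_le (k : ℕ) :
    subspaceCount K M k ≤ Nat.card K ^ (k * (finrank K M - k + 1)) := by
  rcases lt_or_ge (finrank K M) k with hk | hk
  · have hempty : {U : Submodule K M | finrank K U = k} = ∅ :=
      Set.eq_empty_of_forall_notMem fun U hU => (U.finrank_le.trans_lt hk).ne hU
    simp [subspaceCount, hempty]
  refine Nat.le_of_mul_le_mul_right ?_ (prod_pow_sub_pow_pos (Finite.one_lt_card (α := K)) k)
  calc subspaceCount K M k * ∏ i : Fin k, (Nat.card K ^ k - Nat.card K ^ i.val)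
      = ∏ i : Fin k, (Nat.card K ^ (k + (finrank K M - k)) - Nat.card K ^ i.val) := by
        rw [subspaceCount_mul_prod hk, Nat.add_sub_cancel' hk]
    _ ≤ ∏ i : Fin k, (Nat.card K ^ (finrank K M - k + 1)
          * (Nat.card K ^ k - Nat.card K ^ i.val)) :=
        prod_le_prod' fun i _ => pow_sub_pow_le_pow_mul _ Finite.one_lt_card i.2
    _ = Nat.card K ^ (k * (finrank K M - k + 1))
          * ∏ i : Fin k, (Nat.card K ^ k - Nat.card K ^ i.val) := by
        rw [prod_mul_distrib, prod_const, card_univ, Fintype.card_fin, ← pow_mul, mul_comm k]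

theorem natCard_submodule_le :
    Nat.card (Submodule K M) ≤ Nat.card K ^ (finrank K M ^ 2 / 4 + 2 * finrank K M) := by
  set n := finrank K M
  set q := Nat.card K
  have hq1 : 1 < q := Finite.one_lt_card
  have hexp {k : ℕ} (hk : k ≤ n) : k * (n - k + 1) ≤ n ^ 2 / 4 + n := by
    obtain ⟨d, hd⟩ := Nat.exists_eq_add_of_le hk
    have hquarter : k * d ≤ n ^ 2 / 4 := by
      rw [Nat.le_div_iff_mul_le (by lia), hd]
      linarith [four_mul_le_pow_two_add k d]
    rw [hd, Nat.add_sub_cancel_left, ← hd, mul_add_one]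
    lia
  calc Nat.card (Submodule K M) = ∑ k ∈ range (n + 1), subspaceCount K M k :=
        natCard_submodule_eq_sum_subspaceCount
    _ ≤ ∑ _k ∈ range (n + 1), q ^ (n ^ 2 / 4 + n) := sum_le_sum fun k hk =>
        (subspaceCount_le k).trans <|
          Nat.pow_le_pow_right (by lia) (hexp (mem_range_succ_iff.1 hk))
    _ = (n + 1) * q ^ (n ^ 2 / 4 + n) := by rw [sum_const, card_range, smul_eq_mul]
    _ ≤ q ^ n * q ^ (n ^ 2 / 4 + n) := Nat.mul_le_mul_right _ (Nat.lt_pow_self hq1)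
    _ = q ^ (n ^ 2 / 4 + 2 * n) := by rw [← pow_add]; ring_nf

theorem ncard_finrank_eq_and_ge_le (W : Submodule K M) (k : ℕ) :
    {U : Submodule K M | finrank K U = k ∧ W ≤ U}.ncard
      ≤ Nat.card K ^ ((k - finrank K W) * (finrank K M - k + 1)) := by
  have hfinite : Finite (M ⧸ W) := Quotient.finite _
  have hinj : Set.InjOn (Submodule.map W.mkQ)
      {U : Submodule K M | finrank K U = k ∧ W ≤ U} := fun U hU U' hU' h => by
    simpa only [Submodule.comap_map_mkQ, sup_eq_right.2 hU.2, sup_eq_right.2 hU'.2]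
      using congrArg (Submodule.comap W.mkQ) h
  have hcount : {U : Submodule K M | finrank K U = k ∧ W ≤ U}.ncard
      ≤ subspaceCount K (M ⧸ W) (k - finrank K W) :=
    Set.ncard_le_ncard_of_injOn _ (fun U hU => (finrank_map_mkQ hU.2).trans (by rw [hU.1])) hinj
  refine (hcount.trans (subspaceCount_le _)).trans (Nat.pow_le_pow_right Nat.card_pos ?_)
  have hquot := W.finrank_quotient_add_finrank
  rcases le_total k (finrank K W) with hk | _
  · simp [Nat.sub_eq_zero_of_le hk]
  · exact Nat.mul_le_mul_left _ (by lia)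

theorem ncard_finrank_eq_and_le_finrank_inf_le (V : Submodule K M) (k w : ℕ) :
    {U : Submodule K M | finrank K U = k ∧ w ≤ finrank K ↥(U ⊓ V)}.ncard
      ≤ Nat.card K ^ (w * (finrank K V - w + 1) + (k - w) * (finrank K M - k + 1)) := by
  rw [pow_add]
  refine (ncard_le_ncard_mul_of_forall_exists (t := {W | W ≤ V ∧ finrank K W = w})
    (r := fun U W => W ≤ U) (Set.toFinite _) ?_ ?_).trans <| Nat.mul_le_mul_right _ <|
      (ncard_setOf_le_and_finrank_eq V w).trans_le (subspaceCount_le w)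
  · rintro U ⟨-, hU⟩
    obtain ⟨W, hW, hWw⟩ := exists_submodule_le_finrank_eq _ hU
    exact ⟨W, ⟨hW.trans inf_le_right, hWw⟩, hW.trans inf_le_left⟩
  · rintro W ⟨-, rfl⟩
    refine (Set.ncard_le_ncard ?_).trans (ncard_finrank_eq_and_ge_le W k)
    rintro U ⟨⟨hU, -⟩, hWU⟩
    exact ⟨hU, hWU⟩

end DivisionRing

section CoveringCodes

variable {F : Type*} [Field F] {n : ℕ}

theorem injectionDist_eq_zero {U V : ProjSpace F n} : injectionDist U V = 0 ↔ U = V := by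
  refine ⟨fun h => ?_, by rintro rfl; rw [injectionDist, inf_idem, max_self, Nat.sub_self]⟩
  have hUV : U ⊓ V = U := Submodule.eq_of_le_of_finrank_le inf_le_left
    ((le_max_left _ _).trans (Nat.sub_eq_zero_iff_le.1 h))
  have hVU : U ⊓ V = V := Submodule.eq_of_le_of_finrank_le inf_le_right
    ((le_max_right _ _).trans (Nat.sub_eq_zero_iff_le.1 h))
  exact hUV.symm.trans hVU

theorem injectionDist_sup_inf_le {A B : ProjSpace F n} (U : ProjSpace F n) {ρ : ℕ}
    (hA : finrank F A ≤ ρ) (hB : n ≤ finrank F B + ρ) : injectionDist U (A ⊔ U ⊓ B) ≤ ρ := by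
  have hinf : finrank F ↥(U ⊓ B) ≤ finrank F ↥(U ⊓ (A ⊔ U ⊓ B)) :=
    Submodule.finrank_mono (le_inf inf_le_left le_sup_right)
  have hsup : finrank F ↥(A ⊔ U ⊓ B) ≤ finrank F A + finrank F ↥(U ⊓ B) :=
    Submodule.finrank_add_le_finrank_add_finrank _ _
  have hU : finrank F U ≤ finrank F ↥(U ⊓ B) + ρ := by
    have hUB := Submodule.finrank_sup_add_finrank_inf_eq U B
    have hle : finrank F ↥(U ⊔ B) ≤ n := (Submodule.finrank_le _).trans_eq (finrank_fin_fun F)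
    lia
  rw [injectionDist]
  lia

theorem exists_finrank_eq_finrank_eq_le {a b : ℕ} (hab : a ≤ b) (hb : b ≤ n) :
    ∃ A B : ProjSpace F n, A ≤ B ∧ finrank F A = a ∧ finrank F B = b := by
  obtain ⟨B, -, hB⟩ := exists_submodule_le_finrank_eq (⊤ : ProjSpace F n) (k := b) (by simpa)
  obtain ⟨A, hAB, hA⟩ := exists_submodule_le_finrank_eq B (hab.trans hB.ge)
  exact ⟨A, B, hAB, hA, hB⟩

variable [Finite F]

theorem injectionCoveringRadius_le_iff {C : Set (ProjSpace F n)} (hC : C.Nonempty) {ρ : ℕ} :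
    injectionCoveringRadius C ≤ ρ ↔ ∀ U, ∃ V ∈ C, injectionDist U V ≤ ρ := by
  have hdist (U : ProjSpace F n) :
      injectionDistToCode U C ≤ ρ ↔ ∃ V ∈ C, injectionDist U V ≤ ρ := by
    constructor
    · intro h
      obtain ⟨V, hV, hUV⟩ := Nat.sInf_mem (hC.image (injectionDist U))
      exact ⟨V, hV, hUV.trans_le h⟩
    · rintro ⟨V, hV, hUV⟩
      exact (Nat.sInf_le (Set.mem_image_of_mem _ hV)).trans hUV
  rw [injectionCoveringRadius, ciSup_le_iff (Set.finite_range _).bddAbove]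
  exact forall_congr' hdist

theorem minCoveringCard_pos (ρ : ℕ) : 0 < minCoveringCard F n ρ := by
  obtain ⟨C, hC, -, hcard⟩ := exists_minCoveringCard F n ρ
  exact hcard ▸ (Set.ncard_pos).2 hC

theorem minCoveringCard_zero : minCoveringCard F n 0 = Nat.card (ProjSpace F n) := by
  obtain ⟨C, hC, hr, hcard⟩ := exists_minCoveringCard F n 0
  rw [injectionCoveringRadius_le_iff hC] at hr
  have huniv : C = Set.univ := Set.eq_univ_of_forall fun U => by
    obtain ⟨V, hV, hUV⟩ := hr U
    rwa [injectionDist_eq_zero.1 (Nat.le_zero.1 hUV)]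
  rw [← hcard, huniv, Set.ncard_univ]

theorem ncard_finrank_eq_and_injectionDist_le (V : ProjSpace F n) {k ρ : ℕ} (hk : k + ρ ≤ n) :
    {U : ProjSpace F n | finrank F U = k ∧ injectionDist U V ≤ ρ}.ncard
      ≤ Nat.card F ^ (ρ * (n - ρ) + k) := by
  set w := max k (finrank F V) - ρ with _
  have hsub : {U : ProjSpace F n | finrank F U = k ∧ injectionDist U V ≤ ρ}
      ⊆ {U | finrank F U = k ∧ w ≤ finrank F ↥(U ⊓ V)} := fun U ⟨hU, hUV⟩ => by
    rw [injectionDist, hU] at hUV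
    exact ⟨hU, by lia⟩
  rcases Set.eq_empty_or_nonempty {U : ProjSpace F n | finrank F U = k ∧ injectionDist U V ≤ ρ}
    with hempty | ⟨U₀, hU₀⟩
  · simp [hempty]
  have hwk : w ≤ k := (hsub hU₀).2.trans (hU₀.1 ▸ Submodule.finrank_mono inf_le_left)
  calc {U : ProjSpace F n | finrank F U = k ∧ injectionDist U V ≤ ρ}.ncard
      ≤ {U : ProjSpace F n | finrank F U = k ∧ w ≤ finrank F ↥(U ⊓ V)}.ncard :=
        Set.ncard_le_ncard hsub
    _ ≤ Nat.card F ^ (w * (finrank F V - w + 1) + (k - w) * (n - k + 1)) := by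
        simpa only [finrank_fin_fun] using ncard_finrank_eq_and_le_finrank_inf_le V k w
    _ ≤ Nat.card F ^ (ρ * (n - ρ) + k) :=
        Nat.pow_le_pow_right Nat.card_pos (mul_succ_add_sub_mul_succ_le hk hwk (by lia) (by lia))

theorem pow_le_minCoveringCard_mul_pow {k ρ : ℕ} (hk : k + ρ ≤ n) :
    Nat.card F ^ (k * (n - k)) ≤ minCoveringCard F n ρ * Nat.card F ^ (ρ * (n - ρ) + k) := by
  obtain ⟨C, hC, hr, hcard⟩ := exists_minCoveringCard F n ρ
  rw [injectionCoveringRadius_le_iff hC] at hr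
  calc Nat.card F ^ (k * (n - k)) ≤ subspaceCount F (Fin n → F) k := by
        simpa using pow_le_subspaceCount (K := F) (M := Fin n → F) (k := k) (by simp; lia)
    _ ≤ C.ncard * Nat.card F ^ (ρ * (n - ρ) + k) :=
        ncard_le_ncard_mul_of_forall_exists C.toFinite (fun U _ => hr U)
          fun V _ => ncard_finrank_eq_and_injectionDist_le V hk
    _ = minCoveringCard F n ρ * Nat.card F ^ (ρ * (n - ρ) + k) := by rw [hcard]

theorem ncard_Icc_le {A B : ProjSpace F n} (hAB : A ≤ B) :
    (Set.Icc A B).ncard ≤ Nat.card F ^ ((finrank F B - finrank F A) ^ 2 / 4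
      + 2 * (finrank F B - finrank F A)) := by
  have hfinite : Finite (B ⧸ A.submoduleOf B) := Quotient.finite _
  have hdim : finrank F (B ⧸ A.submoduleOf B) = finrank F B - finrank F A := by
    have hquot := (A.submoduleOf B).finrank_quotient_add_finrank
    rw [(Submodule.submoduleOfEquivOfLe hAB).finrank_eq] at hquot
    lia
  let lift (W : Submodule F (B ⧸ A.submoduleOf B)) : ProjSpace F n :=
    (W.comap (A.submoduleOf B).mkQ).map B.subtype
  have hsub : Set.Icc A B ⊆ Set.range lift := fun U ⟨hAU, hUB⟩ => by
    refine ⟨(U.submoduleOf B).map (A.submoduleOf B).mkQ, ?_⟩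
    have hle : A.submoduleOf B ≤ U.submoduleOf B := Submodule.comap_mono hAU
    simp only [lift, Submodule.comap_map_mkQ, sup_eq_right.2 hle]
    rw [Submodule.submoduleOf, Submodule.map_comap_subtype, inf_eq_right.2 hUB]
  calc (Set.Icc A B).ncard ≤ (Set.range lift).ncard := Set.ncard_le_ncard hsub
    _ ≤ Nat.card (Submodule F (B ⧸ A.submoduleOf B)) := Finite.card_range_le lift
    _ ≤ _ := hdim ▸ natCard_submodule_le

theorem minCoveringCard_le_ncard_Icc {A B : ProjSpace F n} (hAB : A ≤ B) {ρ : ℕ}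
    (hA : finrank F A ≤ ρ) (hB : n ≤ finrank F B + ρ) :
    minCoveringCard F n ρ ≤ (Set.Icc A B).ncard := by
  have hC : (Set.Icc A B).Nonempty := Set.nonempty_Icc.2 hAB
  refine Nat.sInf_le ⟨Set.Icc A B, hC, (injectionCoveringRadius_le_iff hC).2 fun U => ?_, rfl⟩
  exact ⟨A ⊔ U ⊓ B, ⟨le_sup_left, sup_le hAB inf_le_right⟩, injectionDist_sup_inf_le U hA hB⟩

theorem minCoveringCard_le (n ρ : ℕ) :
    minCoveringCard F n ρ ≤ Nat.card F ^ ((n - 2 * ρ) ^ 2 / 4 + 2 * (n - 2 * ρ)) := by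
  -- Both occurrences of `n / 2` matter only for `n < 2 * ρ`, where they make the interval a point.
  obtain ⟨A, B, hAB, hA, hB⟩ := exists_finrank_eq_finrank_eq_le (F := F) (n := n)
    (a := min ρ (n / 2)) (b := max (n - ρ) (n / 2)) (by lia) (by lia)
  have hdim : finrank F B - finrank F A = n - 2 * ρ := by lia
  rw [← hdim]
  exact (minCoveringCard_le_ncard_Icc hAB (by lia) (by lia)).trans (ncard_Icc_le hAB)

end CoveringCodes

section Asymptotics

theorem tendsto_div_sq_of_abs_sub_le {a b : ℕ → ℝ} {C l : ℝ}
    (hab : ∀ n : ℕ, |a n - b n| ≤ C * (n + 1))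
    (hb : Tendsto (fun n : ℕ => b n / (n : ℝ) ^ 2) atTop (𝓝 l)) :
    Tendsto (fun n : ℕ => a n / (n : ℝ) ^ 2) atTop (𝓝 l) := by
  have hinv : Tendsto (fun n : ℕ => C * ((n : ℝ)⁻¹ + (n : ℝ)⁻¹ ^ 2)) atTop (𝓝 0) := by
    simpa using (tendsto_inv_atTop_nhds_zero_nat.add
      (tendsto_inv_atTop_nhds_zero_nat.pow 2)).const_mul C
  refine hb.congr_dist (squeeze_zero (fun _ => dist_nonneg) (fun n => ?_) hinv)
  rcases n.eq_zero_or_pos with rfl | hn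
  · simp
  calc dist (b n / (n : ℝ) ^ 2) (a n / (n : ℝ) ^ 2) = |a n - b n| / (n : ℝ) ^ 2 := by
        rw [dist_comm, Real.dist_eq, ← sub_div, abs_div,
          abs_of_nonneg (sq_nonneg (n : ℝ))]
    _ ≤ C * (n + 1) / (n : ℝ) ^ 2 := by gcongr; exact hab n
    _ = C * ((n : ℝ)⁻¹ + (n : ℝ)⁻¹ ^ 2) := by field_simp

theorem natCast_sub_eq_max (m k : ℕ) : ((m - k : ℕ) : ℝ) = max ((m : ℝ) - k) 0 := by
  rw [← sub_self (k : ℝ), max_sub_sub_right, ← Nat.cast_max, ← Nat.sub_add_eq_max, Nat.cast_add,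
    add_sub_cancel_right]

theorem tendsto_natCast_sub_two_mul_floor_div {x : ℝ} (hx : 0 ≤ x) :
    Tendsto (fun n : ℕ => ((n - 2 * ⌊(n : ℝ) * x⌋₊ : ℕ) : ℝ) / n) atTop
      (𝓝 (max (1 - 2 * x) 0)) := by
  have hfloor : Tendsto (fun n : ℕ => (⌊x * n⌋₊ : ℝ) / n) atTop (𝓝 x) :=
    (tendsto_nat_floor_mul_div_atTop hx).comp tendsto_natCast_atTop_atTop
  refine (((hfloor.const_mul 2).const_sub 1).max tendsto_const_nhds).congr' ?_
  filter_upwards [eventually_gt_atTop 0] with n hn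
  have hn' : (n : ℝ) ≠ 0 := by positivity
  rw [natCast_sub_eq_max, ← max_div_div_right n.cast_nonneg, zero_div, sub_div, div_self hn',
    mul_comm x, Nat.cast_mul, Nat.cast_ofNat, mul_div_assoc]

variable {F : Type*} [Field F] [Finite F]

theorem one_lt_natCast_card : (1 : ℝ) < Nat.card F := by exact_mod_cast Finite.one_lt_card

theorem logb_card_pow (e : ℕ) : Real.logb (Nat.card F) ((Nat.card F : ℝ) ^ e) = e := by
  have hq := one_lt_natCast_card (F := F)
  rw [Real.logb_pow, Real.logb_self_eq_one hq, mul_one]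

theorem logb_minCoveringCard_le (n ρ : ℕ) :
    Real.logb (Nat.card F) (minCoveringCard F n ρ) ≤ ((n - 2 * ρ : ℕ) : ℝ) ^ 2 / 4 + 2 * n := by
  set m := n - 2 * ρ
  have hK : (0 : ℝ) < minCoveringCard F n ρ := by exact_mod_cast minCoveringCard_pos ρ
  have hle : (minCoveringCard F n ρ : ℝ) ≤ (Nat.card F : ℝ) ^ (m ^ 2 / 4 + 2 * m) := by
    exact_mod_cast minCoveringCard_le n ρ
  calc Real.logb (Nat.card F) (minCoveringCard F n ρ)
      ≤ Real.logb (Nat.card F) ((Nat.card F : ℝ) ^ (m ^ 2 / 4 + 2 * m)) :=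
        Real.logb_le_logb_of_le one_lt_natCast_card hK hle
    _ = ((m ^ 2 / 4 : ℕ) : ℝ) + 2 * m := by rw [logb_card_pow]; push_cast; rfl
    _ ≤ (m : ℝ) ^ 2 / 4 + 2 * n := by
        gcongr
        · exact Nat.cast_div_le.trans_eq (by push_cast; rfl)
        · exact Nat.sub_le _ _

theorem mul_sub_sub_le_logb_minCoveringCard {n k ρ : ℕ} (hk : k + ρ ≤ n) :
    (k * (n - k) - (ρ * (n - ρ) + k) : ℝ) ≤ Real.logb (Nat.card F) (minCoveringCard F n ρ) := by
  have hq := one_lt_natCast_card (F := F)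
  have hK : (minCoveringCard F n ρ : ℝ) ≠ 0 := by exact_mod_cast (minCoveringCard_pos ρ).ne'
  have hle : (Nat.card F : ℝ) ^ (k * (n - k))
      ≤ minCoveringCard F n ρ * (Nat.card F : ℝ) ^ (ρ * (n - ρ) + k) := by
    exact_mod_cast pow_le_minCoveringCard_mul_pow hk
  have hlog := Real.logb_le_logb_of_le hq (by positivity) hle
  rw [Real.logb_mul hK (by positivity), logb_card_pow, logb_card_pow] at hlog
  push_cast [Nat.cast_sub (show k ≤ n by lia), Nat.cast_sub (show ρ ≤ n by lia)] at hlog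
  linarith

theorem sub_le_logb_minCoveringCard (n ρ : ℕ) :
    ((n - 2 * ρ : ℕ) : ℝ) ^ 2 / 4 - (n + 1) ≤ Real.logb (Nat.card F) (minCoveringCard F n ρ) := by
  rcases le_total n (2 * ρ) with hρ | hρ
  · have hlog : 0 ≤ Real.logb (Nat.card F) (minCoveringCard F n ρ) :=
      Real.logb_nonneg one_lt_natCast_card (by exact_mod_cast minCoveringCard_pos ρ)
    rw [Nat.sub_eq_zero_of_le hρ]
    push_cast
    linarith [n.cast_nonneg (α := ℝ)]
  · have hlog := mul_sub_sub_le_logb_minCoveringCard (F := F) (show n / 2 + ρ ≤ n by lia)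
    have hhalf : (n : ℝ) = 2 * (n / 2 : ℕ) + (n % 2 : ℕ) := by
      exact_mod_cast (Nat.div_add_mod n 2).symm
    have hmod : ((n % 2 : ℕ) : ℝ) ≤ 1 := by exact_mod_cast Nat.lt_succ_iff.1 (n.mod_lt two_pos)
    have hmod_sq : ((n % 2 : ℕ) : ℝ) ^ 2 ≤ 1 := pow_le_one₀ (Nat.cast_nonneg _) hmod
    calc ((n - 2 * ρ : ℕ) : ℝ) ^ 2 / 4 - (n + 1)
        ≤ ((n / 2 : ℕ) : ℝ) * (n - (n / 2 : ℕ)) - (ρ * (n - ρ) + (n / 2 : ℕ)) := by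
          rw [Nat.cast_sub hρ]
          push_cast
          rw [hhalf]
          nlinarith [(n / 2).cast_nonneg (α := ℝ), (n % 2).cast_nonneg (α := ℝ)]
      _ ≤ _ := hlog

variable (F) in
theorem tendsto_logb_minCoveringCard_div_sq {x : ℝ} (hx : 0 ≤ x) :
    Tendsto (fun n : ℕ => Real.logb (Nat.card F) (minCoveringCard F n ⌊(n : ℝ) * x⌋₊) / (n : ℝ) ^ 2)
      atTop (𝓝 (max (1 - 2 * x) 0 ^ 2 / 4)) := by
  refine tendsto_div_sq_of_abs_sub_le (C := 2)
    (b := fun n : ℕ => ((n - 2 * ⌊(n : ℝ) * x⌋₊ : ℕ) : ℝ) ^ 2 / 4) (fun n => ?_) ?_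
  · rw [abs_sub_le_iff]
    constructor
    · linarith [logb_minCoveringCard_le (F := F) n ⌊(n : ℝ) * x⌋₊]
    · linarith [sub_le_logb_minCoveringCard (F := F) n ⌊(n : ℝ) * x⌋₊, n.cast_nonneg (α := ℝ)]
  · simpa only [div_pow, div_right_comm] using
      ((tendsto_natCast_sub_two_mul_floor_div hx).pow 2).div_const 4

theorem injectionCoveringRate_eq_max_sq {ρ' : ℝ} (hρ' : 0 ≤ ρ') :
    injectionCoveringRate F ρ' = ((max (1 - 2 * ρ') 0 ^ 2 : ℝ) : EReal) := by
  have hnum := tendsto_logb_minCoveringCard_div_sq F hρ'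
  have hden := tendsto_logb_minCoveringCard_div_sq F le_rfl
  simp only [mul_zero, Nat.floor_zero, minCoveringCard_zero, sub_zero, zero_le_one, sup_of_le_left,
    one_pow] at hden
  have hquot := hnum.div hden (by norm_num)
  rw [div_div_div_cancel_right₀ (by norm_num), div_one] at hquot
  refine (continuous_coe_real_ereal.tendsto _ |>.comp (hquot.congr' ?_)).liminf_eq
  filter_upwards [eventually_gt_atTop 0] with n hn
  exact div_div_div_cancel_right₀ (by positivity) _ _

end Asymptotics

end SubspaceCodes

theorem mainTheorem6 (F : Type*) [Field F] [Finite F] (ρ' : ℝ) :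
    (0 ≤ ρ' → ρ' ≤ 1 / 2 →
      SubspaceCodes.injectionCoveringRate F ρ' = (((1 - 2 * ρ') ^ 2 : ℝ) : EReal)) ∧
    (1 / 2 ≤ ρ' → SubspaceCodes.injectionCoveringRate F ρ' = 0) := by
  constructor
  · intro h0 hle
    rw [SubspaceCodes.injectionCoveringRate_eq_max_sq h0, max_eq_left (by linarith)]
  · intro hge
    rw [SubspaceCodes.injectionCoveringRate_eq_max_sq (by linarith), max_eq_right (by linarith)]
    norm_num
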